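/- For an even integer $n\ge 2$ let $M_n$ be a random matrix uniformly distributed over the set of all $n\times n$ matrices with entries in $\{-1,0,1\}$ whose entries in each row satisfy $\sum_{j=1}^n |M_n(i,j)| = n/2$ (that is, each row has exactly $n/2$ zero entries; equivalently, the rows are independent and uniformly distributed over the $\{-1,0,1\}$-vectors with exactly $n/2$ zero coordinates). For $\delta,\rho\in(0,1)$, let $\operatorname{Comp}(\delta,\rho)$ be the set of all $x\in\mathbb{R}^n$ with $\|x\|_2=1$ for which there is a vector $y\in\mathbb{R}^n$ with at most $\delta n$ non-zero coordinates such that $\|x-y\|_2\le\rho$. Then there are absolute constants $\delta,\rho,c_{10}\in(0,1)$ (not depending on $n$) such that for every even $n\ge 2$, $$\mathbf{P}\Big(\inf_{x\in\operatorname{Comp}(\delta,\rho)}\|x^{\top}M_n\|_2\le \frac{\sqrt n}{144}\Big)\le 2e^{-c_{10}n},$$ where $\|\cdot\|_2$ is the Euclidean norm and the infimum over the empty set is $+\infty$. -/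

import Mathlib

open MeasureTheory ProbabilityTheory
open scoped Matrix ENNReal

namespace SignedCombinatorial

/-- Real matrices carry the product (Borel) σ-algebra of their entries. -/
instance matrixMeasurableSpace (n : ℕ) : MeasurableSpace (Matrix (Fin n) (Fin n) ℝ) :=
  inferInstanceAs (MeasurableSpace (Fin n → Fin n → ℝ))

instance matrixMeasurableSingletonClass (n : ℕ) :
    MeasurableSingletonClass (Matrix (Fin n) (Fin n) ℝ) :=
  inferInstanceAs (MeasurableSingletonClass (Fin n → Fin n → ℝ))

/-- The set `𝓜` of all `n × n` real matrices with entries in `{-1, 0, 1}` such that in every row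
the absolute values of the entries sum to `n / 2` (a division of real numbers). -/
def signedMatrices (n : ℕ) : Set (Matrix (Fin n) (Fin n) ℝ) :=
  {A | (∀ i j, A i j = -1 ∨ A i j = 0 ∨ A i j = 1) ∧ ∀ i, ∑ j, |A i j| = (n : ℝ) / 2}

/-- The sparse vectors of `ℝⁿ`: those whose support has at most `δ n` elements. -/
def Sparse (n : ℕ) (δ : ℝ) : Set (EuclideanSpace ℝ (Fin n)) :=
  {x | ((Finset.univ.filter fun i => x i ≠ 0).card : ℝ) ≤ δ * n}

/-- The compressible vectors: the unit vectors of `ℝⁿ` that lie within Euclidean distance `ρ`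
of a sparse vector. (The set of sparse vectors is a finite union of subspaces, so the distance
to it is attained.) -/
def Comp (n : ℕ) (δ ρ : ℝ) : Set (EuclideanSpace ℝ (Fin n)) :=
  {x | ‖x‖ = 1 ∧ ∃ y ∈ Sparse n δ, dist x y ≤ ρ}

/-- The infimum of the Euclidean norms `‖xᵀ A‖₂` over the compressible vectors `x`. It is taken
in `[0, ∞]`, so that the infimum over an empty set is `∞`. -/
noncomputable def infComp {n : ℕ} (δ ρ : ℝ) (A : Matrix (Fin n) (Fin n) ℝ) : ℝ≥0∞ :=
  ⨅ x ∈ Comp n δ ρ, ENNReal.ofReal ‖WithLp.toLp 2 (x.ofLp ᵥ* A)‖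

end SignedCombinatorial

/-! Multiplying the entries of a matrix in `signedMatrices n` by a fixed sign pattern permutes that
set. The uniform law is therefore unchanged by independent random signs, and it suffices to bound
the bad event for each fixed `A` under random signs (`ncard_inter_le`,
`measure_le_of_proportion_le`).

For fixed `A` and a unit vector `x`, the coordinates of `xᵀ A` become independent Rademacher sums of
variances at most 1, which add up to `n / 2`. A fourth moment bound controls their Laplace
transforms, so `‖xᵀ A‖ < √n / 4` has probability at most `exp (-n / 32)` (`proportion_norm_lt_le`).

Compressible vectors are approximated by multiples of nonzero integer vectors of squared norm at
most `n / 1152`. There are at most `exp (n / 64)` of these, so the union bound leaves `exp (-n /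
64)` (`proportion_exists_intBall_le`). The approximation error is absorbed by the bound `76 √n` on
the operator norm, which comes from a sub-Gaussian estimate on another integer net
(`proportion_opNorm_le`). `le_norm_of_mem_Comp` combines the two. -/

namespace SignedCombinatorial

open scoped BigOperators

/-! ### Averages over independent signs -/

/-- A uniformly distributed sign, as a real number. -/
abbrev signVal (u : ℤˣ) : ℝ := ((u : ℤ) : ℝ)

theorem sum_update_neg {ι : Type*} [DecidableEq ι] {s : Finset ι} {i : ι} (hi : i ∉ s)
    (c : ι → ℝ) (e : ι → ℤˣ) :
    ∑ j ∈ s, c j * signVal (Function.update e i (-e i) j) = ∑ j ∈ s, c j * signVal (e j) := by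
  refine Finset.sum_congr rfl fun j hj => ?_
  rw [Function.update_of_ne (ne_of_mem_of_not_mem hj hi)]

section Signs

variable {ι κ : Type*} [Fintype ι] [DecidableEq ι] [Fintype κ]

/-- The average of a product of functions of distinct coordinates is the product of the averages. -/
theorem expect_pi_prod (f : ι → κ → ℝ) :
    𝔼 e : ι → κ, ∏ i, f i (e i) = ∏ i, 𝔼 u, f i u := by
  simp only [Fintype.expect_eq_sum_div_card, Finset.prod_div_distrib, Finset.prod_const,
    Fintype.card_pi, Nat.cast_pow, Finset.card_univ]
  rw [Finset.prod_univ_sum, Fintype.piFinset_univ]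

theorem signVal_sq (u : ℤˣ) : signVal u ^ 2 = 1 := by
  rcases Int.units_eq_one_or u with rfl | rfl <;> simp [signVal]

theorem abs_signVal (u : ℤˣ) : |signVal u| = 1 := by
  rcases Int.units_eq_one_or u with rfl | rfl <;> simp [signVal]

theorem expect_sign (f : ℤˣ → ℝ) : 𝔼 u, f u = (f 1 + f (-1)) / 2 := by
  rw [Fintype.expect_eq_sum_div_card]
  have h : (Finset.univ : Finset ℤˣ) = {1, -1} := rfl
  rw [h, Finset.sum_pair (by decide)]
  simp [Fintype.card_units_int]

/-- Sub-Gaussian bound for the moment generating function of a Rademacher sum. -/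
theorem expect_exp_sum_le (c : ι → ℝ) :
    𝔼 e : ι → ℤˣ, Real.exp (∑ i, c i * signVal (e i)) ≤ Real.exp ((∑ i, c i ^ 2) / 2) := by
  simp_rw [Real.exp_sum]
  rw [expect_pi_prod (fun i u => Real.exp (c i * signVal u)), Finset.sum_div, Real.exp_sum]
  refine Finset.prod_le_prod (fun i _ => Finset.expect_nonneg fun _ _ => (Real.exp_pos _).le)
    fun i _ => ?_
  rw [expect_sign]
  have := Real.cosh_le_exp_half_sq (c i)
  rw [Real.cosh_eq] at this
  simpa [signVal] using this

/-- Averaging over the sign of a single coordinate. -/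
theorem expect_flip (i : ι) (f : (ι → ℤˣ) → ℝ) :
    𝔼 e, f e = 𝔼 e, (f e + f (Function.update e i (-e i))) / 2 := by
  have hinv : Function.Involutive fun e : ι → ℤˣ => Function.update e i (-e i) := by
    intro e; simp
  have h : 𝔼 e, f (Function.update e i (-e i)) = 𝔼 e, f e :=
    Fintype.expect_equiv hinv.toPerm _ _ fun _ => rfl
  rw [← Finset.expect_div, Finset.expect_add_distrib, h]
  ring

theorem expect_sum_sq (c : ι → ℝ) (s : Finset ι) :
    𝔼 e : ι → ℤˣ, (∑ i ∈ s, c i * signVal (e i)) ^ 2 = ∑ i ∈ s, c i ^ 2 := by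
  induction s using Finset.induction_on with
  | empty => simp
  | insert i s hi ih =>
    rw [expect_flip i, Finset.sum_insert hi, ← ih, ← Fintype.expect_const (ι := ι → ℤˣ) (c i ^ 2),
      ← Finset.expect_add_distrib]
    refine Finset.expect_congr rfl fun e _ => ?_
    rw [Finset.sum_insert hi, Finset.sum_insert hi, sum_update_neg hi]
    have := signVal_sq (e i)
    simp only [Function.update_self, signVal, Units.val_neg, Int.cast_neg] at this ⊢
    linear_combination c i ^ 2 * this

/-- Flipping the sign of the new coordinate cancels the odd cross terms, leaving `6 c² V + c⁴`, with
`V` the previous variance; this fits in `3 (V + c²)² - 3 V²`. -/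
theorem expect_sum_pow_four_le (c : ι → ℝ) (s : Finset ι) :
    𝔼 e : ι → ℤˣ, (∑ i ∈ s, c i * signVal (e i)) ^ 4 ≤ 3 * (∑ i ∈ s, c i ^ 2) ^ 2 := by
  induction s using Finset.induction_on with
  | empty => simp
  | insert i s hi ih =>
    have key : 𝔼 e : ι → ℤˣ, (∑ j ∈ insert i s, c j * signVal (e j)) ^ 4 =
        𝔼 e : ι → ℤˣ, (∑ j ∈ s, c j * signVal (e j)) ^ 4 +
          6 * c i ^ 2 * 𝔼 e : ι → ℤˣ, (∑ j ∈ s, c j * signVal (e j)) ^ 2 + c i ^ 4 := by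
      rw [expect_flip i, ← Fintype.expect_const (ι := ι → ℤˣ) (c i ^ 4), Finset.mul_expect,
        ← Finset.expect_add_distrib, ← Finset.expect_add_distrib]
      refine Finset.expect_congr rfl fun e _ => ?_
      rw [Finset.sum_insert hi, Finset.sum_insert hi, sum_update_neg hi]
      rcases Int.units_eq_one_or (e i) with h | h <;> simp [signVal, h] <;> ring
    rw [key, expect_sum_sq, Finset.sum_insert hi]
    nlinarith [sq_nonneg (c i ^ 2)]

/-- Uses `(1 - v + v²/2) (1 + v + v²/2) = 1 + v⁴/4 ≥ 1`. -/
theorem exp_neg_le_quadratic {v : ℝ} (hv : 0 ≤ v) : Real.exp (-v) ≤ 1 - v + v ^ 2 / 2 := by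
  have h1 := Real.quadratic_le_exp_of_nonneg hv
  have h2 : Real.exp (-v) * Real.exp v = 1 := by rw [← Real.exp_add]; simp
  have h3 : 0 < 1 - v + v ^ 2 / 2 := by nlinarith [sq_nonneg (v - 1)]
  have h4 : 1 ≤ (1 - v + v ^ 2 / 2) * Real.exp v := by
    nlinarith [mul_le_mul_of_nonneg_left h1 h3.le, sq_nonneg (v ^ 2)]
  rw [Real.exp_neg, inv_le_iff_one_le_mul₀ (Real.exp_pos v)]
  exact h4

/-- A Rademacher sum of variance at most one is not concentrated near zero. -/
theorem expect_exp_neg_sq_le (c : ι → ℝ) (hc : ∑ i, c i ^ 2 ≤ 1) :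
    𝔼 e : ι → ℤˣ, Real.exp (-((∑ i, c i * signVal (e i)) ^ 2 / 6)) ≤
      Real.exp (-((∑ i, c i ^ 2) / 12)) := by
  set v := ∑ i, c i ^ 2 with hv
  have hv0 : 0 ≤ v := Finset.sum_nonneg fun i _ => sq_nonneg _
  calc
    _ ≤ 𝔼 e : ι → ℤˣ, (1 - (1 / 6) * (∑ i, c i * signVal (e i)) ^ 2 +
          (1 / 72) * (∑ i, c i * signVal (e i)) ^ 4) := by
      refine Finset.expect_le_expect fun e _ => (exp_neg_le_quadratic (by positivity)).trans ?_
      apply le_of_eq; ring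
    _ = 1 - (1 / 6) * v + (1 / 72) * 𝔼 e : ι → ℤˣ, (∑ i, c i * signVal (e i)) ^ 4 := by
      rw [Finset.expect_add_distrib, Finset.expect_sub_distrib, ← Finset.mul_expect,
        ← Finset.mul_expect, expect_sum_sq, Fintype.expect_const]
    -- The fourth moment contributes at most `3 v² / 72 = v² / 24`, which is at most `v / 12` since
    -- `v ≤ 1`.
    _ ≤ -(v / 12) + 1 := by
      have := expect_sum_pow_four_le c Finset.univ
      nlinarith
    _ ≤ _ := Real.add_one_le_exp _

/-- The proportion of an event in a finite sample space. -/
noncomputable def proportion (E : Set κ) : ℝ := 𝔼 e, E.indicator (fun _ => (1 : ℝ)) e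

theorem proportion_le_expect (E : Set κ) (f : κ → ℝ) (hf : ∀ e, 0 ≤ f e)
    (h : ∀ e ∈ E, 1 ≤ f e) : proportion E ≤ 𝔼 e, f e :=
  Finset.expect_le_expect fun e _ => Set.indicator_le' (fun a ha => h a ha) (fun a _ => hf a) e

theorem proportion_mono {E F : Set κ} (h : E ⊆ F) : proportion E ≤ proportion F :=
  Finset.expect_le_expect fun e _ =>
    Set.indicator_le_indicator_of_subset h (fun _ => zero_le_one) e

theorem proportion_union_le (E F : Set κ) : proportion (E ∪ F) ≤ proportion E + proportion F := by
  rw [proportion, proportion, proportion, ← Finset.expect_add_distrib]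
  refine Finset.expect_le_expect fun e _ => ?_
  by_cases h1 : e ∈ E <;> by_cases h2 : e ∈ F <;> simp [h1, h2]

theorem proportion_biUnion_le {α : Type*} (s : Finset α) (E : α → Set κ) {p : ℝ}
    (h : ∀ a ∈ s, proportion (E a) ≤ p) : proportion (⋃ a ∈ s, E a) ≤ s.card * p := by
  classical
  induction s using Finset.induction_on with
  | empty => simp [proportion]
  | insert a s ha ih =>
    rw [Finset.set_biUnion_insert, Finset.card_insert_of_notMem ha]
    have h1 := proportion_union_le (E a) (⋃ b ∈ s, E b)
    have h2 := h a (Finset.mem_insert_self a s)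
    have h3 := ih fun b hb => h b (Finset.mem_insert_of_mem hb)
    push_cast
    linarith

end Signs

/-! ### Integer nets -/

section Net

theorem sum_Icc_pow_natAbs_le {r : ℝ} (h0 : 0 ≤ r) (h1 : r ≤ 1 / 2) (N : ℕ) :
    ∑ k ∈ Finset.Icc (-(N : ℤ)) N, r ^ k.natAbs ≤ 1 + 4 * r := by
  -- The subtracted term makes the induction close: each step adds `2 r ^ (N + 1)`, and `4 r ≤ 2`.
  have key : ∑ k ∈ Finset.Icc (-(N : ℤ)) N, r ^ k.natAbs ≤ 1 + 4 * r - 4 * r ^ (N + 1) := by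
    induction N with
    | zero => simp
    | succ N ih =>
      have hI : Finset.Icc (-((N + 1 : ℕ) : ℤ)) ((N + 1 : ℕ) : ℤ) =
          insert (-((N : ℤ) + 1)) (insert ((N : ℤ) + 1) (Finset.Icc (-(N : ℤ)) N)) := by
        ext k
        simp only [Finset.mem_Icc, Finset.mem_insert]
        omega
      rw [hI, Finset.sum_insert, Finset.sum_insert]
      · have e1 : (-((N : ℤ) + 1)).natAbs = N + 1 := by omega
        have e2 : ((N : ℤ) + 1).natAbs = N + 1 := by omega
        rw [e1, e2, pow_succ r (N + 1)]
        have := pow_nonneg h0 (N + 1)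
        nlinarith
      · simp
      · simp only [Finset.mem_insert, Finset.mem_Icc, not_or]
        omega
  have := pow_nonneg h0 (N + 1)
  linarith

/-- The integer points of squared Euclidean norm at most `B`. -/
noncomputable def intBall (n : ℕ) (B : ℝ) : Finset (Fin n → ℤ) :=
  (Fintype.piFinset fun _ => Finset.Icc (-((⌊B⌋₊ : ℕ) : ℤ)) (⌊B⌋₊ : ℕ)).filter
    fun k => ∑ i, (k i : ℝ) ^ 2 ≤ B

theorem abs_le_sq_of_int (k : ℤ) : |(k : ℝ)| ≤ (k : ℝ) ^ 2 := by
  have h : |k| ≤ k ^ 2 := by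
    rw [← sq_abs]
    rcases (abs_nonneg k).eq_or_lt with h | h
    · simp [← h]
    · nlinarith
  exact_mod_cast h

theorem mem_intBall {n : ℕ} {B : ℝ} {k : Fin n → ℤ} :
    k ∈ intBall n B ↔ ∑ i, (k i : ℝ) ^ 2 ≤ B := by
  simp only [intBall, Finset.mem_filter, Fintype.mem_piFinset, Finset.mem_Icc,
    and_iff_right_iff_imp]
  intro h i
  have h1 : |(k i : ℝ)| ≤ B := (abs_le_sq_of_int _).trans <|
    (Finset.single_le_sum (f := fun i => (k i : ℝ) ^ 2) (fun _ _ => sq_nonneg _)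
      (Finset.mem_univ i)).trans h
  have h2 : (k i).natAbs ≤ ⌊B⌋₊ := by
    apply Nat.le_floor
    rw [Nat.cast_natAbs, Int.cast_abs]
    exact h1
  omega

/-- Each point of the ball has weight `exp (s (B - ∑ |k i|)) ≥ 1`, because `|k| ≤ k²` on integers,
and the total weight factors over coordinates. The free parameter `s` makes the exponent a small
multiple of `n` when `B` is. -/
theorem card_intBall_le (n : ℕ) {s : ℝ} (hs : 1 ≤ s) (B : ℝ) :
    ((intBall n B).card : ℝ) ≤ Real.exp (s * B + 4 * Real.exp (-s) * n) := by
  set r := Real.exp (-s) with hr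
  have hr0 : 0 ≤ r := (Real.exp_pos _).le
  have hr1 : r ≤ 1 / 2 := by
    rw [hr, Real.exp_neg, one_div]
    exact inv_anti₀ two_pos (by linarith [Real.add_one_le_exp s])
  have hpow : ∀ k : ℤ, r ^ k.natAbs = Real.exp (-s * |(k : ℝ)|) := fun k => by
    rw [hr, ← Real.exp_nat_mul, Nat.cast_natAbs, Int.cast_abs, mul_comm]
  calc
    ((intBall n B).card : ℝ) = ∑ k ∈ intBall n B, 1 := by simp
    _ ≤ ∑ k ∈ intBall n B, Real.exp (s * B) * ∏ i, r ^ (k i).natAbs := by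
      refine Finset.sum_le_sum fun k hk => ?_
      simp_rw [hpow]
      rw [← Real.exp_sum, ← Real.exp_add, ← Finset.mul_sum]
      refine Real.one_le_exp ?_
      have h1 : ∑ i, |(k i : ℝ)| ≤ ∑ i, (k i : ℝ) ^ 2 :=
        Finset.sum_le_sum fun i _ => abs_le_sq_of_int _
      nlinarith [mem_intBall.1 hk]
    _ ≤ ∑ k ∈ Fintype.piFinset fun _ : Fin n => Finset.Icc (-((⌊B⌋₊ : ℕ) : ℤ)) (⌊B⌋₊ : ℕ),
          Real.exp (s * B) * ∏ i, r ^ (k i).natAbs :=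
      Finset.sum_le_sum_of_subset_of_nonneg (Finset.filter_subset _ _) fun k _ _ => by positivity
    _ = Real.exp (s * B) *
          ∏ _i : Fin n, ∑ k ∈ Finset.Icc (-((⌊B⌋₊ : ℕ) : ℤ)) (⌊B⌋₊ : ℕ), r ^ k.natAbs := by
      rw [← Finset.mul_sum, Finset.prod_univ_sum]
    _ ≤ Real.exp (s * B) * ∏ _i : Fin n, Real.exp (4 * r) := by
      gcongr
      refine (sum_Icc_pow_natAbs_le hr0 hr1 _).trans ?_
      linarith [Real.add_one_le_exp (4 * r)]
    _ = _ := by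
      rw [Finset.prod_const, Finset.card_univ, Fintype.card_fin, ← Real.exp_nat_mul,
        ← Real.exp_add]
      ring_nf

theorem exists_int_trunc (a : ℝ) : ∃ k : ℤ, |(k : ℝ)| ≤ |a| ∧ |a - k| ≤ 1 := by
  rcases le_total 0 a with h | h
  · refine ⟨⌊a⌋, ?_, ?_⟩
    · have : (0 : ℝ) ≤ ⌊a⌋ := by exact_mod_cast Int.floor_nonneg.2 h
      rw [abs_of_nonneg this, abs_of_nonneg h]
      exact Int.floor_le a
    · rw [abs_le]
      constructor <;> linarith [Int.floor_le a, Int.lt_floor_add_one a]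
  · refine ⟨⌈a⌉, ?_, ?_⟩
    · have : (⌈a⌉ : ℝ) ≤ 0 := by exact_mod_cast Int.ceil_le.2 (by simpa using h)
      rw [abs_of_nonpos this, abs_of_nonpos h]
      linarith [Int.le_ceil a]
    · rw [abs_le]
      constructor <;> linarith [Int.le_ceil a, Int.ceil_lt_add_one a]

/-- An integer vector, as a point of Euclidean space. -/
noncomputable def intVec {n : ℕ} (k : Fin n → ℤ) : EuclideanSpace ℝ (Fin n) :=
  WithLp.toLp 2 fun i => (k i : ℝ)

theorem norm_intVec_sq {n : ℕ} (k : Fin n → ℤ) : ‖intVec k‖ ^ 2 = ∑ i, (k i : ℝ) ^ 2 := by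
  simp [EuclideanSpace.real_norm_sq_eq, intVec]

/-- Rounding a vector towards zero to a multiple of an integer vector. -/
theorem exists_intVec_approx {n : ℕ} (y : EuclideanSpace ℝ (Fin n)) {m L : ℝ} (hL : 0 < L)
    (hm : ((Finset.univ.filter fun i => y i ≠ 0).card : ℝ) ≤ m) :
    ∃ k : Fin n → ℤ, ‖intVec k‖ ≤ L * ‖y‖ ∧ ‖y - L⁻¹ • intVec k‖ ^ 2 ≤ m / L ^ 2 := by
  choose k hk1 hk2 using fun i => exists_int_trunc (L * y i)
  refine ⟨k, ?_, ?_⟩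
  · refine le_of_sq_le_sq ?_ (by positivity)
    rw [norm_intVec_sq, mul_pow, EuclideanSpace.real_norm_sq_eq, Finset.mul_sum]
    refine Finset.sum_le_sum fun i _ => ?_
    rw [← mul_pow]
    exact sq_le_sq.2 (hk1 i)
  -- Rounding towards zero keeps zero coordinates, so only the support of `y` contributes error.
  · have hi : ∀ i, (y i - L⁻¹ * k i) ^ 2 ≤ if y i ≠ 0 then 1 / L ^ 2 else 0 := by
      intro i
      split_ifs with h
      · have e : y i - L⁻¹ * k i = (L * y i - k i) / L := by field_simp
        rw [e, div_pow]
        gcongr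
        rw [← sq_abs]
        exact pow_le_one₀ (abs_nonneg _) (hk2 i)
      · have h0 : y i = 0 := not_not.1 h
        have := hk1 i
        rw [h0, mul_zero, abs_zero] at this
        simp [h0, abs_nonpos_iff.1 this]
    rw [EuclideanSpace.real_norm_sq_eq]
    calc
      _ ≤ ∑ i, if y i ≠ 0 then 1 / L ^ 2 else 0 := Finset.sum_le_sum fun i _ => by
        simpa [intVec] using hi i
      _ = ((Finset.univ.filter fun i => y i ≠ 0).card : ℝ) * (1 / L ^ 2) := by
        rw [← Finset.sum_filter, Finset.sum_const, nsmul_eq_mul]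
      _ ≤ m * (1 / L ^ 2) := by gcongr
      _ = _ := by ring

end Net

/-! ### Deterministic estimates for linear maps -/

section Deterministic

variable {n : ℕ} (T : EuclideanSpace ℝ (Fin n) →L[ℝ] EuclideanSpace ℝ (Fin n))

/-- The operator norm is controlled by the bilinear form on a net of integer vectors. -/
theorem opNorm_le_of_intBall (hn : 0 < n) {C : ℝ} (hC : 0 ≤ C)
    (h : ∀ k ∈ intBall n (16 * n), ∀ l ∈ intBall n (16 * n),
      inner ℝ (T (intVec k)) (intVec l) ≤ 16 * n * C) :
    ‖T‖ ≤ 2 * C := by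
  have hn' : (0 : ℝ) < n := by exact_mod_cast hn
  -- At this scale the rounding error is at most `√(n / L²) = 1/4`; the two roundings in the
  -- bilinear form cost `‖T‖ / 2`, absorbed at the end.
  set L : ℝ := 4 * √(n : ℝ) with hLdef
  have hL : 0 < L := by positivity
  have hL2 : L ^ 2 = 16 * n := by rw [hLdef, mul_pow, Real.sq_sqrt hn'.le]; norm_num
  have hround : ∀ x : EuclideanSpace ℝ (Fin n), ‖x‖ = 1 →
      ∃ k ∈ intBall n (16 * n), ‖L⁻¹ • intVec k‖ ≤ 1 ∧ ‖x - L⁻¹ • intVec k‖ ≤ 1 / 4 := by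
    intro x hx
    obtain ⟨k, hk1, hk2⟩ := exists_intVec_approx x (m := n) hL (by
      exact_mod_cast (Finset.card_le_univ _).trans (by simp))
    rw [hx, mul_one] at hk1
    refine ⟨k, mem_intBall.2 ?_, ?_, ?_⟩
    · rw [← norm_intVec_sq, ← hL2]
      exact pow_le_pow_left₀ (norm_nonneg _) hk1 2
    · rw [norm_smul, norm_inv, Real.norm_of_nonneg hL.le, inv_mul_le_iff₀ hL]
      linarith
    · refine le_of_sq_le_sq (hk2.trans ?_) (by norm_num)
      rw [hL2]
      apply le_of_eq
      field_simp
      norm_num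
  have hbil : ∀ x z : EuclideanSpace ℝ (Fin n), ‖x‖ = 1 → ‖z‖ = 1 →
      inner ℝ (T x) z ≤ C + ‖T‖ / 2 := by
    intro x z hx hz
    obtain ⟨k, hk, hk1, hk2⟩ := hround x hx
    obtain ⟨l, hl, hl1, hl2⟩ := hround z hz
    set p := L⁻¹ • intVec k with hp
    set q := L⁻¹ • intVec l with hq
    have e : inner ℝ (T x) z = inner ℝ (T p) q + inner ℝ (T (x - p)) z +
        inner ℝ (T p) (z - q) := by
      simp only [map_sub, inner_sub_left, inner_sub_right]
      ring
    have h1 : inner ℝ (T p) q ≤ C := by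
      rw [hp, hq, map_smul, real_inner_smul_left, real_inner_smul_right, ← mul_assoc,
        ← mul_inv, ← sq, hL2, inv_mul_le_iff₀ (by positivity)]
      exact h k hk l hl
    have h2 : inner ℝ (T (x - p)) z ≤ ‖T‖ * (1 / 4) := by
      refine (real_inner_le_norm _ _).trans ?_
      rw [hz, mul_one]
      exact (T.le_opNorm _).trans (by gcongr)
    have h3 : inner ℝ (T p) (z - q) ≤ ‖T‖ * 1 * (1 / 4) := by
      refine (real_inner_le_norm _ _).trans ?_
      gcongr
      exact (T.le_opNorm _).trans (by gcongr)
    linarith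
  have : ‖T‖ ≤ C + ‖T‖ / 2 := by
    refine ContinuousLinearMap.opNorm_le_of_unit_norm (by positivity) fun x hx => ?_
    by_cases h0 : T x = 0
    · rw [h0, norm_zero]; positivity
    · have h1 := hbil x (‖T x‖⁻¹ • T x) hx (by
        rw [norm_smul, norm_inv, norm_norm, inv_mul_cancel₀ (norm_ne_zero_iff.2 h0)])
      rw [real_inner_smul_right, real_inner_self_eq_norm_sq, sq, ← mul_assoc,
        inv_mul_cancel₀ (norm_ne_zero_iff.2 h0), one_mul] at h1
      exact h1
  linarith

/-- A lower bound on integer vectors and an upper bound on the operator norm give a lower bound on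
compressible vectors. -/
theorem le_norm_of_mem_Comp (hn : 0 < n) {δ ρ K a : ℝ} (hδ : 0 < δ) (hρ : 0 < ρ)
    (hρ1 : ρ ≤ 1 / 4) (ha : 0 ≤ a) (hT : ‖T‖ ≤ K)
    (h : ∀ k ∈ intBall n (4 * (δ * n / ρ ^ 2)), k ≠ 0 → a * ‖intVec k‖ ≤ ‖T (intVec k)‖)
    {x : EuclideanSpace ℝ (Fin n)} (hx : x ∈ Comp n δ ρ) : a / 2 - 2 * ρ * K ≤ ‖T x‖ := by
  obtain ⟨hx1, y, hy, hxy⟩ := hx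
  rw [dist_eq_norm] at hxy
  have hn' : (0 : ℝ) < n := by exact_mod_cast hn
  -- Chosen so that rounding a vector with `δ n` nonzero coordinates costs at most `ρ`; since `‖y‖ ≤
  -- 2`, the net radius is `2 L`.
  set L : ℝ := √(δ * n) / ρ with hLdef
  have hL : 0 < L := by positivity
  have hL2 : L ^ 2 = δ * n / ρ ^ 2 := by rw [hLdef, div_pow, Real.sq_sqrt (by positivity)]
  obtain ⟨k, hk1, hk2⟩ := exists_intVec_approx y hL hy
  have hyz : ‖y - L⁻¹ • intVec k‖ ≤ ρ := by
    refine le_of_sq_le_sq (hk2.trans ?_) hρ.le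
    rw [hL2]
    apply le_of_eq
    field_simp
  set z := L⁻¹ • intVec k with hz
  have hxz : ‖x - z‖ ≤ 2 * ρ := by
    have := norm_sub_le_norm_sub_add_norm_sub x y z
    linarith
  have hy2 : ‖y‖ ≤ 2 := by
    have := norm_sub_norm_le y x
    rw [norm_sub_rev] at this
    linarith
  have hz2 : 1 / 2 ≤ ‖z‖ := by
    have := norm_sub_norm_le x z
    linarith
  have hk0 : k ≠ 0 := by
    rintro rfl
    have : intVec (0 : Fin n → ℤ) = 0 := by ext i; simp [intVec]
    rw [hz, this, smul_zero, norm_zero] at hz2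
    linarith
  have hkB : k ∈ intBall n (4 * (δ * n / ρ ^ 2)) := by
    rw [mem_intBall, ← norm_intVec_sq, ← hL2]
    have : ‖intVec k‖ ≤ 2 * L := by nlinarith
    nlinarith [norm_nonneg (intVec k)]
  have hTz : a * ‖z‖ ≤ ‖T z‖ := by
    rw [hz, map_smul, norm_smul, norm_smul, mul_left_comm]
    exact mul_le_mul_of_nonneg_left (h k hkB hk0) (norm_nonneg _)
  have h1 : ‖T (x - z)‖ ≤ K * (2 * ρ) :=
    (T.le_opNorm _).trans (mul_le_mul hT hxz (norm_nonneg _) ((norm_nonneg _).trans hT))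
  have h2 : ‖T z‖ ≤ ‖T x‖ + ‖T (x - z)‖ := by
    rw [map_sub]
    exact norm_le_norm_add_norm_sub (T x) (T z)
  nlinarith

end Deterministic

/-! ### Matrices with random signs -/

section SignMatrix

variable {n : ℕ}

/-- The matrix `A` with its entries multiplied by signs; the signs are indexed by columns first. -/
def signTwist (A : Matrix (Fin n) (Fin n) ℝ) (e : Fin n → Fin n → ℤˣ) :
    Matrix (Fin n) (Fin n) ℝ :=
  Matrix.of fun i j => A i j * signVal (e j i)

/-- The map `x ↦ xᵀ A` of Euclidean space. -/
noncomputable def rowMap (A : Matrix (Fin n) (Fin n) ℝ) :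
    EuclideanSpace ℝ (Fin n) →L[ℝ] EuclideanSpace ℝ (Fin n) :=
  Matrix.toEuclideanCLM (𝕜 := ℝ) Aᵀ

theorem rowMap_apply (A : Matrix (Fin n) (Fin n) ℝ) (x : EuclideanSpace ℝ (Fin n)) :
    rowMap A x = WithLp.toLp 2 (x.ofLp ᵥ* A) := by
  ext i
  simp [rowMap, Matrix.mulVec_transpose]

theorem rowMap_signTwist_apply (A : Matrix (Fin n) (Fin n) ℝ) (e : Fin n → Fin n → ℤˣ)
    (x : EuclideanSpace ℝ (Fin n)) (j : Fin n) :
    rowMap (signTwist A e) x j = ∑ i, x i * A i j * signVal (e j i) := by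
  simp [rowMap_apply, Matrix.vecMul, dotProduct, signTwist, mul_assoc]

/-- Laplace transform of `‖xᵀ A‖²` for a unit vector `x` and random signs. -/
theorem expect_exp_neg_norm_sq_le {A : Matrix (Fin n) (Fin n) ℝ} (hA : ∀ i j, A i j ^ 2 ≤ 1)
    (hrow : ∀ i, ∑ j, A i j ^ 2 = (n : ℝ) / 2) {x : EuclideanSpace ℝ (Fin n)} (hx : ‖x‖ = 1) :
    𝔼 e, Real.exp (-(‖rowMap (signTwist A e) x‖ ^ 2 / 6)) ≤ Real.exp (-(n / 24)) := by
  have hx2 : ∑ i, x i ^ 2 = 1 := by rw [← EuclideanSpace.real_norm_sq_eq, hx, one_pow]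
  have hexp : ∀ e, Real.exp (-(‖rowMap (signTwist A e) x‖ ^ 2 / 6)) =
      ∏ j, Real.exp (-((∑ i, x i * A i j * signVal (e j i)) ^ 2 / 6)) := by
    intro e
    rw [← Real.exp_sum, EuclideanSpace.real_norm_sq_eq, Finset.sum_div, Finset.sum_neg_distrib]
    simp_rw [rowMap_signTwist_apply]
  simp_rw [hexp]
  -- Coordinate `j` involves only the signs `e j` of column `j`, so the average factors over
  -- columns.
  rw [expect_pi_prod (fun j (u : Fin n → ℤˣ) =>
    Real.exp (-((∑ i, x i * A i j * signVal (u i)) ^ 2 / 6)))]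
  calc
    _ ≤ ∏ j, Real.exp (-((∑ i, (x i * A i j) ^ 2) / 12)) := by
      refine Finset.prod_le_prod
        (fun j _ => Finset.expect_nonneg fun _ _ => (Real.exp_pos _).le) fun j _ => ?_
      refine expect_exp_neg_sq_le (fun i => x i * A i j) ?_
      rw [← hx2]
      refine Finset.sum_le_sum fun i _ => ?_
      rw [mul_pow]
      exact mul_le_of_le_one_right (sq_nonneg _) (hA i j)
    _ = _ := by
      rw [← Real.exp_sum, Finset.sum_neg_distrib, ← Finset.sum_div, Finset.sum_comm]
      simp_rw [mul_pow, ← Finset.mul_sum, hrow]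
      rw [← Finset.sum_mul, hx2]
      ring_nf

/-- Markov's inequality for the Laplace transform: the exponents combine to `n / 96 - n / 24 = -n /
32`. -/
theorem proportion_norm_lt_le {A : Matrix (Fin n) (Fin n) ℝ} (hA : ∀ i j, A i j ^ 2 ≤ 1)
    (hrow : ∀ i, ∑ j, A i j ^ 2 = (n : ℝ) / 2) {x : EuclideanSpace ℝ (Fin n)} (hx : x ≠ 0) :
    proportion {e | ‖rowMap (signTwist A e) x‖ < √(n : ℝ) / 4 * ‖x‖} ≤
      Real.exp (-(n / 32)) := by
  have hx0 : 0 < ‖x‖ := norm_pos_iff.2 hx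
  set u := ‖x‖⁻¹ • x with hu
  have hu1 : ‖u‖ = 1 := by
    rw [hu, norm_smul, norm_inv, norm_norm, inv_mul_cancel₀ hx0.ne']
  calc
    _ ≤ 𝔼 e, Real.exp (n / 96) * Real.exp (-(‖rowMap (signTwist A e) u‖ ^ 2 / 6)) := by
      refine proportion_le_expect _ _ (fun e => by positivity) fun e he => ?_
      rw [← Real.exp_add]
      refine Real.one_le_exp ?_
      have h1 : ‖rowMap (signTwist A e) u‖ ≤ √(n : ℝ) / 4 := by
        rw [hu, map_smul, norm_smul, norm_inv, norm_norm, inv_mul_le_iff₀ hx0, mul_comm]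
        exact le_of_lt he
      have h2 := pow_le_pow_left₀ (norm_nonneg _) h1 2
      rw [div_pow, Real.sq_sqrt (Nat.cast_nonneg n)] at h2
      linarith
    _ ≤ Real.exp (n / 96) * Real.exp (-(n / 24)) := by
      rw [← Finset.mul_expect]
      gcongr
      exact expect_exp_neg_norm_sq_le hA hrow hu1
    _ = _ := by rw [← Real.exp_add]; ring_nf

/-- The form is a Rademacher sum with coefficients `x i * A i j * z j`, whose squares sum to at most
`‖x‖² ‖z‖²`. -/
theorem expect_exp_inner_le {A : Matrix (Fin n) (Fin n) ℝ} (hA : ∀ i j, A i j ^ 2 ≤ 1) (t : ℝ)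
    (x z : EuclideanSpace ℝ (Fin n)) :
    𝔼 e, Real.exp (t * inner ℝ (rowMap (signTwist A e) x) z) ≤
      Real.exp (t ^ 2 * ‖x‖ ^ 2 * ‖z‖ ^ 2 / 2) := by
  have hexp : ∀ e, Real.exp (t * inner ℝ (rowMap (signTwist A e) x) z) =
      ∏ j, Real.exp (∑ i, t * (x i * A i j * z j) * signVal (e j i)) := by
    intro e
    rw [← Real.exp_sum, PiLp.inner_apply, Finset.mul_sum]
    congr 1
    refine Finset.sum_congr rfl fun j _ => ?_
    rw [rowMap_signTwist_apply]
    simp only [RCLike.inner_apply, conj_trivial, Finset.mul_sum]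
    refine Finset.sum_congr rfl fun i _ => ?_
    ring
  simp_rw [hexp]
  rw [expect_pi_prod (fun j (u : Fin n → ℤˣ) =>
    Real.exp (∑ i, t * (x i * A i j * z j) * signVal (u i)))]
  calc
    _ ≤ ∏ j, Real.exp (t ^ 2 * ‖x‖ ^ 2 * z j ^ 2 / 2) := by
      refine Finset.prod_le_prod
        (fun j _ => Finset.expect_nonneg fun _ _ => (Real.exp_pos _).le) fun j _ => ?_
      refine (expect_exp_sum_le fun i => t * (x i * A i j * z j)).trans ?_
      refine Real.exp_le_exp.2 ?_
      rw [EuclideanSpace.real_norm_sq_eq, Finset.mul_sum, Finset.sum_mul]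
      gcongr with i _
      calc (t * (x i * A i j * z j)) ^ 2 = t ^ 2 * x i ^ 2 * z j ^ 2 * A i j ^ 2 := by ring
        _ ≤ t ^ 2 * x i ^ 2 * z j ^ 2 := mul_le_of_le_one_right (by positivity) (hA i j)
    _ = _ := by
      rw [← Real.exp_sum, ← Finset.sum_div, ← Finset.mul_sum, ← EuclideanSpace.real_norm_sq_eq]

theorem proportion_opNorm_le {A : Matrix (Fin n) (Fin n) ℝ} (hA : ∀ i j, A i j ^ 2 ≤ 1)
    (hn : 0 < n) :
    proportion {e | ¬ ‖rowMap (signTwist A e)‖ ≤ 76 * √(n : ℝ)} ≤ Real.exp (-n) := by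
  have hn' : (0 : ℝ) < n := by exact_mod_cast hn
  set N := intBall n (16 * n) with hN
  have hcard : (N.card : ℝ) ≤ Real.exp (18 * n) := by
    refine (card_intBall_le n le_rfl _).trans (Real.exp_le_exp.2 ?_)
    have h1 : Real.exp (-1) ≤ 1 / 2 := by
      rw [Real.exp_neg, one_div]
      exact inv_anti₀ two_pos (by linarith [Real.add_one_le_exp (1 : ℝ)])
    nlinarith
  have hpair : ∀ p ∈ N ×ˢ N, proportion {e | 16 * n * (38 * √(n : ℝ)) <
      inner ℝ (rowMap (signTwist A e) (intVec p.1)) (intVec p.2)} ≤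
        Real.exp (n / 2 - 38 * n) := by
    rintro ⟨k, l⟩ hkl
    obtain ⟨hk, hl⟩ := Finset.mem_product.1 hkl
    rw [hN, mem_intBall, ← norm_intVec_sq] at hk hl
    -- This `t` makes the exponent `-38 n + n / 2`, which beats the `36 n` coming from pairs of net
    -- points.
    set t := √(n : ℝ) / (16 * n) with ht
    have ht0 : 0 ≤ t := by positivity
    have ht2 : t * (16 * n * (38 * √(n : ℝ))) = 38 * n := by
      rw [ht]
      field_simp
      rw [Real.sq_sqrt hn'.le]
    have ht3 : t ^ 2 * (16 * n) * (16 * n) = n := by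
      rw [ht]
      field_simp
      rw [Real.sq_sqrt hn'.le]
    calc
      _ ≤ 𝔼 e, Real.exp (-(38 * n)) *
          Real.exp (t * inner ℝ (rowMap (signTwist A e) (intVec k)) (intVec l)) := by
        refine proportion_le_expect _ _ (fun e => by positivity) fun e he => ?_
        rw [← Real.exp_add]
        refine Real.one_le_exp ?_
        have := mul_le_mul_of_nonneg_left (le_of_lt he) ht0
        rw [ht2] at this
        linarith
      _ ≤ Real.exp (-(38 * n)) * Real.exp (t ^ 2 * (16 * n) * (16 * n) / 2) := by
        rw [← Finset.mul_expect]
        gcongr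
        refine (expect_exp_inner_le hA t _ _).trans (Real.exp_le_exp.2 ?_)
        gcongr
      _ = _ := by rw [ht3, ← Real.exp_add]; ring_nf
  calc
    _ ≤ proportion (⋃ p ∈ N ×ˢ N, {e | 16 * n * (38 * √(n : ℝ)) <
          inner ℝ (rowMap (signTwist A e) (intVec p.1)) (intVec p.2)}) := by
      refine proportion_mono fun e he => ?_
      by_contra hcon
      simp only [Set.mem_iUnion, Set.mem_ofPred_eq, not_exists, not_lt] at hcon
      refine he ((opNorm_le_of_intBall _ hn (C := 38 * √(n : ℝ)) (by positivity)
        fun k hk l hl => hcon (k, l) (Finset.mk_mem_product hk hl)).trans (le_of_eq ?_))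
      ring
    _ ≤ (N ×ˢ N).card * Real.exp (n / 2 - 38 * n) := proportion_biUnion_le _ _ hpair
    _ ≤ (Real.exp (18 * n) * Real.exp (18 * n)) * Real.exp (n / 2 - 38 * n) := by
      rw [Finset.card_product]
      push_cast
      gcongr
    _ ≤ _ := by
      rw [← Real.exp_add, ← Real.exp_add]
      exact Real.exp_le_exp.2 (by linarith)

theorem proportion_exists_intBall_le {A : Matrix (Fin n) (Fin n) ℝ} (hA : ∀ i j, A i j ^ 2 ≤ 1)
    (hrow : ∀ i, ∑ j, A i j ^ 2 = (n : ℝ) / 2) :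
    proportion {e | ∃ k ∈ intBall n (n / 1152), k ≠ 0 ∧
      ‖rowMap (signTwist A e) (intVec k)‖ < √(n : ℝ) / 4 * ‖intVec k‖} ≤
        Real.exp (-(n / 64)) := by
  have hexp9 : Real.exp (-9) ≤ 1 / 512 := by
    rw [Real.exp_neg, one_div]
    refine inv_anti₀ (by norm_num) ?_
    have h2 : (2 : ℝ) ≤ Real.exp 1 := by linarith [Real.add_one_le_exp (1 : ℝ)]
    have h9 : Real.exp 9 = Real.exp 1 ^ 9 := by rw [← Real.exp_nat_mul]; norm_num
    rw [h9]
    calc (512 : ℝ) = 2 ^ 9 := by norm_num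
      _ ≤ _ := pow_le_pow_left₀ two_pos.le h2 9
  calc
    _ ≤ proportion (⋃ k ∈ (intBall n (n / 1152)).filter (· ≠ 0),
          {e | ‖rowMap (signTwist A e) (intVec k)‖ < √(n : ℝ) / 4 * ‖intVec k‖}) := by
      refine proportion_mono ?_
      rintro e ⟨k, hk, hk0, h⟩
      exact Set.mem_biUnion (Finset.mem_filter.2 ⟨hk, hk0⟩) h
    _ ≤ ((intBall n (n / 1152)).filter (· ≠ 0)).card * Real.exp (-(n / 32)) := by
      refine proportion_biUnion_le _ _ fun k hk => proportion_norm_lt_le hA hrow ?_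
      intro h0
      refine (Finset.mem_filter.1 hk).2 (funext fun i => ?_)
      simpa [intVec] using congrArg (fun v : EuclideanSpace ℝ (Fin n) => v i) h0
    -- With `s = 9` both terms of the net exponent are at most `n / 128`, half of the available `n /
    -- 32` in total.
    _ ≤ Real.exp (9 * (n / 1152) + 4 * Real.exp (-9) * n) * Real.exp (-(n / 32)) := by
      gcongr
      refine le_trans ?_ (card_intBall_le n (by norm_num) _)
      exact_mod_cast Finset.card_filter_le _ _
    _ ≤ _ := by
      rw [← Real.exp_add]
      refine Real.exp_le_exp.2 ?_
      have := mul_le_mul_of_nonneg_right hexp9 (Nat.cast_nonneg (α := ℝ) n)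
      linarith

/-- The proximity parameter of the compressible vectors. -/
noncomputable def compRho : ℝ := 1 / 10944

/-- The sparsity parameter of the compressible vectors. -/
noncomputable def compDelta : ℝ := compRho ^ 2 / 4608

theorem proportion_infComp_le {A : Matrix (Fin n) (Fin n) ℝ} (hA : ∀ i j, A i j ^ 2 ≤ 1)
    (hrow : ∀ i, ∑ j, A i j ^ 2 = (n : ℝ) / 2) (hn : 0 < n) :
    proportion {e | infComp compDelta compRho (signTwist A e) ≤
      ENNReal.ofReal (√(n : ℝ) / 144)} ≤ 2 * Real.exp (-(1 / 64) * n) := by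
  have hn' : (0 : ℝ) < n := by exact_mod_cast hn
  have hs : 0 < √(n : ℝ) := Real.sqrt_pos.2 hn'
  have hρ : 0 < compRho := by norm_num [compRho]
  refine (proportion_mono ?_).trans <| (proportion_union_le _ _).trans <|
    (add_le_add (proportion_opNorm_le hA hn) (proportion_exists_intBall_le hA hrow)).trans ?_
  · intro e he
    by_contra hcon
    simp only [Set.mem_union, Set.mem_ofPred_eq, not_or, not_not, not_exists, not_and,
      not_lt] at hcon
    obtain ⟨h1, h2⟩ := hcon
    have hB : 4 * (compDelta * n / compRho ^ 2) = (n : ℝ) / 1152 := by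
      rw [compDelta]
      field_simp
      norm_num
    have h3 : ENNReal.ofReal (√(n : ℝ) / 9) ≤
        infComp compDelta compRho (signTwist A e) := by
      refine le_iInf₂ fun x hx => ENNReal.ofReal_le_ofReal ?_
      rw [← rowMap_apply]
      have := le_norm_of_mem_Comp (rowMap (signTwist A e)) hn (a := √(n : ℝ) / 4)
        (by rw [compDelta]; positivity) hρ (by norm_num [compRho]) (by positivity) h1
        (by rw [hB]; exact h2) hx
      -- Here `2 ρ · 76 = 1/72`, and `1/8 - 1/72 = 1/9`.
      refine le_trans (le_of_eq ?_) this
      rw [compRho]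
      ring
    have h4 := h3.trans he
    rw [ENNReal.ofReal_le_ofReal_iff (by positivity)] at h4
    linarith
  · have h1 : Real.exp (-(n : ℝ)) ≤ Real.exp (-(1 / 64) * n) :=
      Real.exp_le_exp.2 (by linarith)
    have h2 : Real.exp (-((n : ℝ) / 64)) = Real.exp (-(1 / 64) * n) := by ring_nf
    linarith

end SignMatrix

/-! ### Sign symmetry of the uniform distribution -/

section Symmetry

variable {n : ℕ}

theorem sq_eq_abs_of_mem_signedMatrices {A : Matrix (Fin n) (Fin n) ℝ}
    (hA : A ∈ signedMatrices n) (i j : Fin n) : A i j ^ 2 = |A i j| := by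
  rcases hA.1 i j with h | h | h <;> simp [h]

theorem sq_le_one_of_mem_signedMatrices {A : Matrix (Fin n) (Fin n) ℝ}
    (hA : A ∈ signedMatrices n) (i j : Fin n) : A i j ^ 2 ≤ 1 := by
  rcases hA.1 i j with h | h | h <;> simp [h]

theorem finite_signedMatrices (n : ℕ) : (signedMatrices n).Finite := by
  have h : (Set.univ.pi fun _ : Fin n => Set.univ.pi fun _ : Fin n =>
      ({-1, 0, 1} : Set ℝ)).Finite :=
    Set.Finite.pi fun _ => Set.Finite.pi fun _ => by simp
  refine h.subset fun A hA i _ j _ => ?_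
  simpa using hA.1 i j

theorem signTwist_mem {A : Matrix (Fin n) (Fin n) ℝ} (hA : A ∈ signedMatrices n)
    (e : Fin n → Fin n → ℤˣ) : signTwist A e ∈ signedMatrices n := by
  refine ⟨fun i j => ?_, fun i => ?_⟩
  · rcases hA.1 i j with h | h | h <;> rcases Int.units_eq_one_or (e j i) with h' | h' <;>
      simp [signTwist, signVal, h, h']
  · rw [← hA.2 i]
    refine Finset.sum_congr rfl fun j _ => ?_
    simp only [signTwist, Matrix.of_apply, abs_mul, abs_signVal, mul_one]

theorem signTwist_signTwist (A : Matrix (Fin n) (Fin n) ℝ) (e : Fin n → Fin n → ℤˣ) :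
    signTwist (signTwist A e) e = A := by
  ext i j
  simp only [signTwist, Matrix.of_apply, mul_assoc, ← sq, signVal_sq, mul_one]

/-- An event that is rare under random signs is rare under the uniform distribution. -/
theorem ncard_inter_le (B : Set (Matrix (Fin n) (Fin n) ℝ)) {p : ℝ}
    (h : ∀ A ∈ signedMatrices n, proportion {e | signTwist A e ∈ B} ≤ p) :
    ((signedMatrices n ∩ B).ncard : ℝ) ≤ p * (signedMatrices n).ncard := by
  classical
  set S := (finite_signedMatrices n).toFinset with hS
  have hmem : ∀ {A}, A ∈ S ↔ A ∈ signedMatrices n := fun {A} => Set.Finite.mem_toFinset _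
  set f : Matrix (Fin n) (Fin n) ℝ → ℝ := B.indicator fun _ => 1 with hf
  -- Twisting by `e` is an involution of `S`. Averaging over `e` and swapping the sums then reduces
  -- the count to the bound for each fixed `A`.
  have hinv : ∀ e : Fin n → Fin n → ℤˣ, ∑ A ∈ S, f (signTwist A e) = ∑ A ∈ S, f A := fun e =>
    Finset.sum_nbij' (fun A => signTwist A e) (fun A => signTwist A e)
      (fun A hA => hmem.2 (signTwist_mem (hmem.1 hA) e))
      (fun A hA => hmem.2 (signTwist_mem (hmem.1 hA) e))
      (fun A _ => signTwist_signTwist A e) (fun A _ => signTwist_signTwist A e) fun A _ => rfl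
  have hcount : ((signedMatrices n ∩ B).ncard : ℝ) = ∑ A ∈ S, f A := by
    have : signedMatrices n ∩ B = ((S.filter (· ∈ B) : Finset _) : Set _) := by
      ext A
      simp [hmem]
    rw [this, Set.ncard_coe_finset, hf, Finset.card_filter]
    push_cast
    exact Finset.sum_congr rfl fun A _ => by rw [Set.indicator_apply]
  rw [hcount, ← Fintype.expect_const (ι := Fin n → Fin n → ℤˣ) (∑ A ∈ S, f A)]
  rw [Finset.expect_congr rfl fun e _ => (hinv e).symm, Finset.expect_sum_comm]
  calc
    _ ≤ ∑ A ∈ S, p := Finset.sum_le_sum fun A hA => h A (hmem.1 hA)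
    _ = _ := by
      rw [Finset.sum_const, nsmul_eq_mul, mul_comm, Set.ncard_eq_toFinset_card _
        (finite_signedMatrices n)]

theorem measure_le_of_proportion_le {Ω : Type*} [MeasurableSpace Ω] {P : Measure Ω}
    {M : Ω → Matrix (Fin n) (Fin n) ℝ} (hM : HasLaw M (uniformOn (signedMatrices n)) P)
    (B : Set (Matrix (Fin n) (Fin n) ℝ)) {p : ℝ} (hp : 0 ≤ p)
    (h : ∀ A ∈ signedMatrices n, proportion {e | signTwist A e ∈ B} ≤ p) :
    P {ω | M ω ∈ B} ≤ ENNReal.ofReal p := by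
  have hfin := finite_signedMatrices n
  have hSm : MeasurableSet (signedMatrices n) := hfin.measurableSet
  -- `B` need not be measurable; it is replaced by this measurable superset, which adds only points
  -- outside the support of the uniform law.
  have hT : MeasurableSet ((signedMatrices n)ᶜ ∪ (signedMatrices n ∩ B)) :=
    hSm.compl.union (hfin.inter_of_left B).measurableSet
  calc
    P {ω | M ω ∈ B} ≤ P (M ⁻¹' ((signedMatrices n)ᶜ ∪ (signedMatrices n ∩ B))) := by
      refine measure_mono fun ω hω => ?_
      by_cases hS : M ω ∈ signedMatrices n
      · exact Or.inr ⟨hS, hω⟩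
      · exact Or.inl hS
    _ = uniformOn (signedMatrices n) ((signedMatrices n)ᶜ ∪ (signedMatrices n ∩ B)) := by
      rw [← hM.map_eq, Measure.map_apply_of_aemeasurable hM.aemeasurable hT]
    _ = (Measure.count (signedMatrices n))⁻¹ * Measure.count (signedMatrices n ∩ B) := by
      rw [uniformOn, cond_apply hSm]
      congr 2
      ext A
      simp only [Set.mem_inter_iff, Set.mem_union, Set.mem_compl_iff]
      tauto
    _ ≤ (Measure.count (signedMatrices n))⁻¹ *
          (ENNReal.ofReal p * Measure.count (signedMatrices n)) := by
      gcongr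
      rw [Measure.count_apply hSm, Measure.count_apply (hfin.inter_of_left B).measurableSet,
        ← hfin.cast_ncard_eq, ← (hfin.inter_of_left B).cast_ncard_eq]
      simp only [ENat.toENNReal_coe]
      rw [← ENNReal.ofReal_natCast, ← ENNReal.ofReal_natCast (Set.ncard (signedMatrices n)),
        ← ENNReal.ofReal_mul hp]
      exact ENNReal.ofReal_le_ofReal (ncard_inter_le B h)
    _ ≤ ENNReal.ofReal p := by
      rw [mul_left_comm]
      exact mul_le_of_le_one_right' (ENNReal.inv_mul_le_one _)

end Symmetry

end SignedCombinatorial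

theorem proposition5p1 :
    ∃ δ ρ c : ℝ, 0 < δ ∧ δ < 1 ∧ 0 < ρ ∧ ρ < 1 ∧ 0 < c ∧ c < 1 ∧
      ∀ n : ℕ, Even n →
        ∀ (Ω : Type*) [MeasurableSpace Ω] (P : Measure Ω) [IsProbabilityMeasure P]
          (M : Ω → Matrix (Fin n) (Fin n) ℝ),
          HasLaw M (uniformOn (SignedCombinatorial.signedMatrices n)) P →
            P {ω | SignedCombinatorial.infComp δ ρ (M ω) ≤ ENNReal.ofReal (√(n : ℝ) / 144)} ≤
              ENNReal.ofReal (2 * Real.exp (-c * n)) := by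
  refine ⟨SignedCombinatorial.compDelta, SignedCombinatorial.compRho, 1 / 64, ?_, ?_, ?_, ?_,
    by norm_num, by norm_num, ?_⟩
  iterate 4 norm_num [SignedCombinatorial.compDelta, SignedCombinatorial.compRho]
  intro n _ Ω _ P _ M hM
  rcases Nat.eq_zero_or_pos n with rfl | hn
  -- For `n = 0` the right-hand side is 2.
  · refine prob_le_one.trans ?_
    simp
  · refine SignedCombinatorial.measure_le_of_proportion_le hM
      {A | SignedCombinatorial.infComp _ _ A ≤ ENNReal.ofReal (√(n : ℝ) / 144)} (by positivity)
      fun A hA => SignedCombinatorial.proportion_infComp_le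
        (SignedCombinatorial.sq_le_one_of_mem_signedMatrices hA) (fun i => ?_) hn
    simp_rw [SignedCombinatorial.sq_eq_abs_of_mem_signedMatrices hA]
    exact hA.2 i
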